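/- Let $\mathcal{A}=\bigl(\prod_{p}\mathbb{Z}/p\mathbb{Z}\bigr)/\bigl(\bigoplus_{p}\mathbb{Z}/p\mathbb{Z}\bigr)$, where $p$ runs over all primes. For $k\ge 2$ put $\mathfrak{Z}_{\mathcal{A}}(k)=\bigl(\tfrac{B_{p-k}}{k}\bmod p\bigr)_p\in\mathcal{A}$, where $B_n$ are the Bernoulli numbers defined by $\frac{te^t}{e^t-1}=\sum_{n\ge0}\frac{B_n}{n!}t^n$ (the finitely many primes $p\le k$ do not matter), and let $\psi_{\mathcal{A}}(x)=\sum_{n\ge2}\mathfrak{Z}_{\mathcal{A}}(n)x^n\in\mathcal{A}[[x]]$. Write $(x)_n=x(x+1)\cdots(x+n-1)$. A family of power series $f_p\in\mathbb{F}_p[[a,b,c]]$ defines, coefficient by coefficient, an element $(f_p)_p\in\mathcal{A}[[a,b,c]]$. Let $a,b,c$ be indeterminates. Then $(a-b)(a-c)$ is not a zero divisor in $\mathcal{A}[[a,b,c]]$, and in $\mathcal{A}[[a,b,c]]$ we have $$\Biggl(\sum_{n=1}^{p-1}\frac{2n+a}{n(n+a)}\,\frac{(b)_n(c)_n}{(1+a-b)_n(1+a-c)_n}\bmod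 p\Biggr)_p$$ $$=\frac{1}{(a-b)(a-c)}\bigl\{(a-b-c)\psi_{\mathcal{A}}(a)+a\,\psi_{\mathcal{A}}(a-b-c)+b\,\psi_{\mathcal{A}}(c)+c\,\psi_{\mathcal{A}}(b)-(c-a)\psi_{\mathcal{A}}(b-a)-(b-a)\psi_{\mathcal{A}}(c-a)\bigr\}.$$ Here the right-hand side denotes the unique element of $\mathcal{A}[[a,b,c]]$ whose product with $(a-b)(a-c)$ is the expression in braces; that such an element exists is part of the claim. -/

import Mathlib

namespace FiniteMZV

instance factPrime (p : Nat.Primes) : Fact (p : ℕ).Prime := ⟨p.2⟩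

/-- The ideal `⨁_p ℤ/pℤ` of `∏_p ℤ/pℤ`: the families with only finitely many nonzero entries. -/
def finSuppIdeal : Ideal (∀ p : Nat.Primes, ZMod (p : ℕ)) where
  carrier := {f | {p | f p ≠ 0}.Finite}
  zero_mem' := by simp
  add_mem' := by
    intro f g hf hg
    refine (hf.union hg).subset fun p hp => ?_
    by_contra h
    simp only [Set.mem_union, Set.mem_ofPred_eq, not_or, not_not] at h
    exact hp (by simp [h.1, h.2])
  smul_mem' := by
    intro c f hf
    refine hf.subset fun p hp h => hp ?_
    simp [h]

/-- The ring `𝒜 = (∏_p ℤ/pℤ) / (⨁_p ℤ/pℤ)`. -/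
abbrev A : Type := (∀ p : Nat.Primes, ZMod (p : ℕ)) ⧸ finSuppIdeal

/-- The class `(f_p)_p ∈ 𝒜` of a family `f_p ∈ ℤ/pℤ`. -/
def toA (f : ∀ p : Nat.Primes, ZMod (p : ℕ)) : A := Ideal.Quotient.mk finSuppIdeal f

/-- The element `(f_p)_p ∈ 𝒜⟦a, b, c⟧` attached to a family `f_p ∈ 𝔽_p⟦a, b, c⟧`:
each coefficient is the class in `𝒜` of the family of the corresponding coefficients. -/
def seriesToA (f : ∀ p : Nat.Primes, MvPowerSeries (Fin 3) (ZMod (p : ℕ))) :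
    MvPowerSeries (Fin 3) A :=
  fun m => toA fun p => MvPowerSeries.coeff m (f p)

/-- `ℨ_𝒜(k) = (B_{p-k} / k mod p)_p` for `k ≥ 2`. Here `bernoulli'` is normalized by
`t e^t / (e^t - 1) = ∑ B_n t^n / n!`, and the cast `ℚ → ℤ/pℤ` sends a `p`-integral rational
(such as `B_{p-k} / k` for `2 ≤ k < p`) to its reduction modulo `p`. The finitely many primes
`p ≤ k` do not affect the class in `𝒜`. -/
noncomputable def frakZ (k : ℕ) : A :=
  toA fun p => ((bernoulli' ((p : ℕ) - k) / (k : ℚ) : ℚ) : ZMod (p : ℕ))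

/-- `ψ_𝒜(x) = ∑_{n ≥ 2} ℨ_𝒜(n) x^n ∈ 𝒜⟦x⟧`. -/
noncomputable def psiSeries : PowerSeries A :=
  PowerSeries.mk fun n => if 2 ≤ n then frakZ n else 0

/-- `ψ_𝒜(y) ∈ 𝒜⟦a, b, c⟧`, for `y ∈ 𝒜⟦a, b, c⟧` without constant term. -/
noncomputable def psiA (y : MvPowerSeries (Fin 3) A) : MvPowerSeries (Fin 3) A :=
  psiSeries.subst y

/-- The Pochhammer symbol `(x)_n = x (x + 1) ⋯ (x + n - 1)`. -/
noncomputable def poch {R : Type*} [CommRing R] (x : R) (n : ℕ) : R :=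
  (ascPochhammer R n).eval x

/-- The sum
`∑_{n=1}^{p-1} (2n + a) / (n (n + a)) * (b)_n (c)_n / ((1 + a - b)_n (1 + a - c)_n)`
modulo `p`, in `𝔽_p⟦a, b, c⟧`. For `1 ≤ n ≤ p - 1` the denominators are products of factors
with constant term in `{1, …, p - 1}`, so they are invertible in `𝔽_p⟦a, b, c⟧`. -/
noncomputable def dougallSum (p : Nat.Primes) : MvPowerSeries (Fin 3) (ZMod (p : ℕ)) :=
  let a : MvPowerSeries (Fin 3) (ZMod (p : ℕ)) := MvPowerSeries.X 0
  let b : MvPowerSeries (Fin 3) (ZMod (p : ℕ)) := MvPowerSeries.X 1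
  let c : MvPowerSeries (Fin 3) (ZMod (p : ℕ)) := MvPowerSeries.X 2
  ∑ n ∈ Finset.Icc 1 ((p : ℕ) - 1),
    ((2 * n + a) * ((n : MvPowerSeries (Fin 3) (ZMod (p : ℕ))) * (n + a))⁻¹) *
      ((poch b n * poch c n) * (poch (1 + a - b) n * poch (1 + a - c) n)⁻¹)

end FiniteMZV

/-!
Let `P(x) = (x)_p = x (x + 1) ⋯ (x + p - 1)`. The identity is the coefficient of `p` in a classical
summation formula, taken modulo `p²`.

* The terminating very well poised `₅F₄(1)` series with parameters `a; b, c, -N` has a closed form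
  (`sum_dougallTerm`). Take `N = p`. The factor `(-p)_n / n!` is `-p / n` modulo `p²` for
  `0 < n < p`, so the middle terms add up to `-p` times the sum in the theorem
  (`dougall_term_mod_sq`). Apart from a factor that is `1` modulo `p²`
  (`poch_one_add_add_prime`), the terms `n = 0` and `n = p` and the closed form involve only the
  values of `P(x)` at `b`, `c` and of `P(x + 1)` at `a`, `a - b`, `a - c`, `a - b - c`.
* By Glaisher's congruence (`exists_coeff_ascPochhammer_eq`) the coefficient of `x ^ m` in `P` is
  `p B_{p-m} / m` modulo `p²` for `2 ≤ m < p`. Hence `P(x) = (p - 1)! x + p ψ(x)` and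
  `P(x + 1) = P(x) - p`, modulo `p²` and up to terms of degree at least `p - 1`
  (`poch_prime`, `poch_one_add_prime`).
* Substituting, the terms without `p` cancel, and the coefficient of `p` is the
  assertion (`dougall_mod_sq`).

The computation modulo `p²` takes place in `ℤ_p⟦a, b, c⟧`, modulo the terms of degree at least
`p - 2` (`coeff_dougallSum`); a given coefficient is below this bound for almost all `p`, which is
all that matters in `𝒜`. Finally `ψ_𝒜` is odd (`psiA_neg`), which accounts for the signs in
`ψ_𝒜(b - a)` and `ψ_𝒜(c - a)`.
-/

namespace FiniteMZV

open Finset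
open Polynomial hiding bernoulli sum_bernoulli bernoulli_zero

/-! ### Bernoulli numbers and the coefficients of `x (x + 1) ⋯ (x + p - 1)` -/

/-- The ring `ℤ_(p)` of `p`-integral rational numbers, as a subring of `ℚ`. -/
def pIntegral (p : ℕ) [Fact p.Prime] : Subring ℚ where
  carrier := {q | (q.den : ZMod p) ≠ 0}
  mul_mem' := by
    intro a b ha hb h
    have h2 : ((a.den * b.den : ℕ) : ZMod p) ≠ 0 := by
      push_cast; exact mul_ne_zero ha hb
    obtain ⟨c, hc⟩ := Rat.mul_den_dvd a b
    rw [hc] at h2; push_cast at h2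
    exact h2 (by rw [h, zero_mul])
  one_mem' := by simp
  add_mem' := by
    intro a b ha hb h
    have h2 : ((a.den * b.den : ℕ) : ZMod p) ≠ 0 := by
      push_cast; exact mul_ne_zero ha hb
    obtain ⟨c, hc⟩ := Rat.add_den_dvd a b
    rw [hc] at h2; push_cast at h2
    exact h2 (by rw [h, zero_mul])
  zero_mem' := by simp
  neg_mem' := by intro a ha; simpa using ha

lemma mem_pIntegral {p : ℕ} [Fact p.Prime] {q : ℚ} : q ∈ pIntegral p ↔ (q.den : ZMod p) ≠ 0 :=
  Iff.rfl

/-- Reduction modulo `p` of `p`-integral rationals; it is the cast `ℚ → ℤ/pℤ`. -/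
def reduction (p : ℕ) [Fact p.Prime] : pIntegral p →+* ZMod p where
  toFun q := ((q : ℚ) : ZMod p)
  map_one' := by simp
  map_zero' := by simp
  map_mul' a b := by
    push_cast; exact Rat.cast_mul_of_ne_zero a.2 b.2
  map_add' a b := by
    push_cast; exact Rat.cast_add_of_ne_zero a.2 b.2

lemma inv_natCast_mem_pIntegral {p : ℕ} [Fact p.Prime] {n : ℕ} (h0 : 0 < n) (hn : n < p) :
    (n : ℚ)⁻¹ ∈ pIntegral p := by
  rw [mem_pIntegral, Rat.inv_natCast_den_of_pos h0, Ne, ZMod.natCast_eq_zero_iff]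
  exact Nat.not_dvd_of_pos_of_lt h0 hn

/-- The easy half of the von Staudt–Clausen theorem. -/
lemma bernoulli_mem_pIntegral {p : ℕ} [Fact p.Prime] (j : ℕ) (hj : j + 1 < p) :
    bernoulli j ∈ pIntegral p := by
  induction j using Nat.strong_induction_on with
  | _ j ih =>
    rcases Nat.eq_zero_or_pos j with rfl | hj0
    · simp
    have h := sum_bernoulli (j + 1)
    rw [if_neg (by lia), sum_range_succ, Nat.choose_succ_self_right] at h
    have h1 : ((j + 1 : ℕ) : ℚ) ≠ 0 := by positivity
    have h2 : bernoulli j = -(∑ k ∈ range j, ((j + 1).choose k : ℚ) * bernoulli k) *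
        ((j + 1 : ℕ) : ℚ)⁻¹ := by
      field_simp
      linear_combination h
    rw [h2]
    refine mul_mem (neg_mem (sum_mem fun k hk => ?_)) (inv_natCast_mem_pIntegral (by lia) hj)
    have := mem_range.1 hk
    exact mul_mem (natCast_mem _ _) (ih k this (by lia))

/-- The recursion for Bernoulli numbers, reduced modulo `p`. -/
lemma sum_bernoulli_zmod {p : ℕ} [Fact p.Prime] (j : ℕ) (hj0 : 0 < j) (hj : j + 1 < p) :
    ∑ i ∈ range (j + 1), ((j + 1).choose i : ZMod p) * ((bernoulli i : ℚ) : ZMod p) = 0 := by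
  have h := sum_bernoulli (j + 1)
  rw [if_neg (by lia)] at h
  let b : ℕ → pIntegral p := fun i =>
    if hi : i + 1 < p then ⟨bernoulli i, bernoulli_mem_pIntegral i hi⟩ else 0
  have hb : ∀ i ∈ range (j + 1), ((b i : pIntegral p) : ℚ) = bernoulli i := by
    intro i hi
    have := mem_range.1 hi
    simp only [b]
    rw [dif_pos (by lia)]
  have h2 : ∑ i ∈ range (j + 1), ((j + 1).choose i : pIntegral p) * b i = 0 := by
    apply Subtype.ext
    push_cast
    rw [← h]
    exact sum_congr rfl fun i hi => by rw [hb i hi]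
  have h3 := congrArg (reduction p) h2
  rw [map_sum, map_zero] at h3
  rw [← h3]
  refine sum_congr rfl fun i hi => ?_
  rw [map_mul, map_natCast, ← hb i hi]
  rfl

/-- Comparison of coefficients in `x (x + 1)_n = (x)_n (x + n)`. -/
lemma coeff_ascPochhammer_rec (n j : ℕ) (hj : j < n) :
    (j : ℤ) * (ascPochhammer ℤ n).coeff (n - j) =
      ∑ i ∈ range j, (ascPochhammer ℤ n).coeff (n - i) * ((n - i).choose (j + 1 - i) : ℤ) := by
  obtain ⟨r, rfl⟩ : ∃ r, n = j + 1 + r := ⟨n - j - 1, by lia⟩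
  set n := j + 1 + r with hn
  have h : X * (ascPochhammer ℤ n).comp (X + 1) = ascPochhammer ℤ n * (X + (n : ℤ[X])) := by
    rw [← ascPochhammer_succ_left, ascPochhammer_succ_right]
  have hdeg : (ascPochhammer ℤ n).natDegree < n + 1 := by
    rw [ascPochhammer_natDegree]; lia
  have h1 : ((ascPochhammer ℤ n).comp (X + 1)).coeff r =
      ∑ m ∈ range (n + 1), (ascPochhammer ℤ n).coeff m * (m.choose r : ℤ) := by
    conv_lhs => rw [(ascPochhammer ℤ n).as_sum_range' (n + 1) hdeg]
    simp [finsetSum_coeff, coeff_X_add_one_pow]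
  have h2 := congrArg (fun q => q.coeff (r + 1)) h
  simp only [coeff_X_mul, mul_add, coeff_add, coeff_mul_X, coeff_mul_natCast] at h2
  rw [h1, ← sum_range_reflect] at h2
  have h3 : n + 1 = j + 2 + r := by lia
  rw [h3, sum_range_add, sum_range_succ, sum_range_succ] at h2
  have h4 : ∀ x ∈ range r, (ascPochhammer ℤ n).coeff (j + 2 + r - 1 - (j + 2 + x)) *
      ((j + 2 + r - 1 - (j + 2 + x)).choose r : ℤ) = 0 := by
    intro x hx
    have := mem_range.1 hx
    rw [Nat.choose_eq_zero_of_lt (by lia)]; simp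
  rw [sum_eq_zero h4] at h2
  have e1 : j + 2 + r - 1 - j = r + 1 := by lia
  have e2 : j + 2 + r - 1 - (j + 1) = r := by lia
  have e3 : n - j = r + 1 := by lia
  rw [e1, e2] at h2
  rw [e3]
  have h5 : ∑ x ∈ range j, (ascPochhammer ℤ n).coeff (j + 2 + r - 1 - x) *
      ((j + 2 + r - 1 - x).choose r : ℤ) = ∑ i ∈ range j, (ascPochhammer ℤ n).coeff (n - i) *
        ((n - i).choose (j + 1 - i) : ℤ) := by
    refine sum_congr rfl fun i hi => ?_
    have := mem_range.1 hi
    have e4 : j + 2 + r - 1 - i = n - i := by lia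
    rw [e4, Nat.choose_symm_of_eq_add (show n - i = r + (j + 1 - i) by lia)]
  rw [h5] at h2
  simp only [Nat.choose_succ_self_right, Nat.choose_self, hn] at h2 ⊢
  push_cast at h2 ⊢
  linear_combination -h2

/-- `binom(p - i, r) ≡ (-1)^r binom(i + r - 1, r)` modulo `p` for `i ≥ 1`, with `i + 1` for `i`. -/
lemma choose_prime_sub {p : ℕ} [Fact p.Prime] (i r : ℕ) (h : i + 1 + r ≤ p) :
    ((p - (i + 1)).choose r : ZMod p) = (-1) ^ r * ((i + r).choose r : ZMod p) := by
  have hf : ((r.factorial : ℕ) : ZMod p) ≠ 0 := by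
    rw [Ne, ZMod.natCast_eq_zero_iff, (Fact.out : p.Prime).dvd_factorial]; lia
  have h1 : ∀ r, i + 1 + r ≤ p → (((p - (i + 1)).descFactorial r : ℕ) : ZMod p) =
      (-1) ^ r * (((i + 1).ascFactorial r : ℕ) : ZMod p) := by
    intro r
    induction r with
    | zero => simp
    | succ r ih =>
      intro h
      rw [Nat.descFactorial_succ, Nat.ascFactorial_succ]
      push_cast
      rw [ih (by lia), Nat.cast_sub (by lia), Nat.cast_sub (by lia)]
      push_cast
      rw [CharP.cast_eq_zero]
      ring
  have h2 := h1 r h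
  rw [Nat.descFactorial_eq_factorial_mul_choose, Nat.ascFactorial_eq_factorial_mul_choose] at h2
  push_cast at h2
  apply mul_left_cancel₀ hf
  rw [h2]
  ring

/-- The Stirling numbers `[p, m]`, `2 ≤ m < p`, are divisible by `p`. -/
lemma dvd_coeff_ascPochhammer {p : ℕ} [Fact p.Prime] (j : ℕ) (hj0 : 0 < j) (hj : j + 1 < p) :
    (p : ℤ) ∣ (ascPochhammer ℤ p).coeff (p - j) := by
  have hp : p.Prime := Fact.out
  induction j using Nat.strong_induction_on with
  | _ j ih =>
    have h := coeff_ascPochhammer_rec p j (by lia)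
    have h1 : (p : ℤ) ∣ (j : ℤ) * (ascPochhammer ℤ p).coeff (p - j) := by
      rw [h]
      refine dvd_sum fun i hi => ?_
      have hi := mem_range.1 hi
      rcases Nat.eq_zero_or_pos i with rfl | hi0
      · apply Dvd.dvd.mul_left
        simpa using Int.natCast_dvd_natCast.2 (hp.dvd_choose_self (by lia) (by lia))
      · exact Dvd.dvd.mul_right (ih i hi hi0 (by lia)) _
    refine (((Nat.prime_iff_prime_int.1 hp).dvd_mul).1 h1).resolve_left fun h2 => ?_
    exact Nat.not_dvd_of_pos_of_lt hj0 (by lia) (Int.natCast_dvd_natCast.1 h2)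

lemma neg_one_pow_mul_bernoulli (j : ℕ) : (-1) ^ j * bernoulli j = bernoulli' j := by
  rw [bernoulli, ← mul_assoc, ← mul_pow]; simp

/-- The inductive form of Glaisher's congruence, with `j = p - m`: modulo `p`, the recursion
`coeff_ascPochhammer_rec` divided by `p` is the recursion of the Bernoulli numbers. -/
lemma glaisher_aux {p : ℕ} [Fact p.Prime] (d : ℕ → ℤ) (hd : ∀ j, 0 < j → j + 1 < p →
      (ascPochhammer ℤ p).coeff (p - j) = p * d j) (j : ℕ) (hj0 : 0 < j) (hj : j + 1 < p) :
    (j : ZMod p) * (d j : ZMod p) = -((-1) ^ j * ((bernoulli j : ℚ) : ZMod p)) := by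
  have hp : p.Prime := Fact.out
  have hpz : (p : ℤ) ≠ 0 := by exact_mod_cast hp.ne_zero
  induction j using Nat.strong_induction_on with
  | _ j ih =>
    obtain ⟨j, rfl⟩ : ∃ l, j = l + 1 := ⟨j - 1, by lia⟩
    have h := coeff_ascPochhammer_rec p (j + 1) (by lia)
    rw [hd _ hj0 hj, sum_range_succ'] at h
    obtain ⟨q, hq⟩ : ∃ q : ℕ, p.choose (j + 2) = p * q := hp.dvd_choose_self (by lia) (by lia)
    have hmon : (ascPochhammer ℤ p).coeff p = 1 := by
      have := (monic_ascPochhammer ℤ p).coeff_natDegree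
      rwa [ascPochhammer_natDegree] at this
    have hsum : ∑ i ∈ range j, (ascPochhammer ℤ p).coeff (p - (i + 1)) *
        ((p - (i + 1)).choose (j + 1 + 1 - (i + 1)) : ℤ) =
        p * ∑ i ∈ range j, d (i + 1) * ((p - (i + 1)).choose (j + 1 - i) : ℤ) := by
      rw [mul_sum]
      refine sum_congr rfl fun i hi => ?_
      have := mem_range.1 hi
      rw [hd _ (by lia) (by lia), show j + 1 + 1 - (i + 1) = j + 1 - i by lia, mul_assoc]
    rw [hsum] at h
    simp only [Nat.sub_zero, hmon] at h
    rw [show j + 1 + 1 = j + 2 from rfl, hq] at h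
    have h1 : ((j + 1 : ℕ) : ℤ) * d (j + 1) =
        ∑ i ∈ range j, d (i + 1) * ((p - (i + 1)).choose (j + 1 - i) : ℤ) + q := by
      apply mul_left_cancel₀ hpz
      push_cast at h ⊢
      linear_combination h
    have hj2 : ((j + 2 : ℕ) : ZMod p) ≠ 0 := by
      rw [Ne, ZMod.natCast_eq_zero_iff]
      exact Nat.not_dvd_of_pos_of_lt (by lia) (by lia)
    have h2 := congrArg (fun z : ℤ => (z : ZMod p)) h1
    push_cast at h2
    -- the term coming from the leading coefficient of `(x)_p`
    have hq2 : ((j + 2 : ℕ) : ZMod p) * q = (-1) ^ (j + 1) := by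
      have e : (j + 2) * q = (p - 1).choose (j + 1) := by
        apply Nat.eq_of_mul_eq_mul_left hp.pos
        have := Nat.add_one_mul_choose_eq (p - 1) (j + 1)
        rw [show p - 1 + 1 = p by have := hp.pos; lia, show j + 1 + 1 = j + 2 from rfl, hq] at this
        rw [this]; ring
      have e2 := choose_prime_sub (p := p) 0 (j + 1) (by lia)
      simp only [zero_add, Nat.choose_self, Nat.cast_one, mul_one] at e2
      rw [← e2, ← e]
      push_cast; ring
    have h3 := sum_bernoulli_zmod (p := p) (j + 1) hj0 hj
    rw [sum_range_succ, sum_range_succ'] at h3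
    have h4 : ((j + 2 : ℕ) : ZMod p) * ∑ i ∈ range j, (d (i + 1) : ZMod p) *
        ((p - (i + 1)).choose (j + 1 - i) : ZMod p) =
        (-1) ^ (j + 1) * ∑ i ∈ range j, ((j + 1 + 1).choose (i + 1) : ZMod p) *
          ((bernoulli (i + 1) : ℚ) : ZMod p) := by
      rw [mul_sum, mul_sum]
      refine sum_congr rfl fun i hi => ?_
      have hi := mem_range.1 hi
      have e1 := ih (i + 1) (by lia) (by lia) (by lia)
      rw [choose_prime_sub (p := p) i (j + 1 - i) (by lia),
        show i + (j + 1 - i) = j + 1 by lia, Nat.choose_symm (show i ≤ j + 1 by lia)]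
      have e2 := congrArg (fun n : ℕ => (n : ZMod p)) (Nat.add_one_mul_choose_eq (j + 1) i)
      push_cast at e1 e2 ⊢
      have e3 : (-1 : ZMod p) ^ (j + 1) = (-1) ^ (j + 1 - i) * (-1) ^ i := by
        rw [← pow_add, show j + 1 - i + i = j + 1 by lia]
      have e4 : (-1 : ZMod p) ^ i * (-1) ^ i = 1 := by rw [← mul_pow]; simp
      rw [e3]
      rw [pow_succ] at e1
      linear_combination (d (i + 1) : ZMod p) * (-1) ^ (j + 1 - i) * e2 +
        ((j + 1 + 1).choose (i + 1) : ZMod p) * (-1) ^ (j + 1 - i) * e1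
    apply mul_left_cancel₀ hj2
    simp only [Nat.choose_succ_self_right, Nat.choose_zero_right, bernoulli_zero] at h3
    push_cast at h2 h3 h4 hq2 ⊢
    linear_combination ((j : ZMod p) + 2) * h2 + h4 + hq2 + (-1) ^ (j + 1) * h3

/-- Glaisher's congruence: for `2 ≤ m < p` the coefficient of `x ^ m` in `x (x + 1) ⋯ (x + p - 1)`
is `p B_{p-m} / m` modulo `p²`. -/
lemma exists_coeff_ascPochhammer_eq {p : ℕ} [Fact p.Prime] (m : ℕ) (hm : 2 ≤ m) (hmp : m < p) :
    ∃ d : ℤ, (ascPochhammer ℤ p).coeff m = p * d ∧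
      (d : ZMod p) = ((bernoulli' (p - m) / (m : ℚ) : ℚ) : ZMod p) := by
  have hdv : ∀ j, ∃ d : ℤ, 0 < j → j + 1 < p → (ascPochhammer ℤ p).coeff (p - j) = p * d := by
    intro j
    by_cases h : 0 < j ∧ j + 1 < p
    · obtain ⟨d, hd⟩ := dvd_coeff_ascPochhammer j h.1 h.2
      exact ⟨d, fun _ _ => hd⟩
    · exact ⟨0, fun h1 h2 => absurd ⟨h1, h2⟩ h⟩
  choose d hd using hdv
  have hj : p - m + 1 < p := by lia
  have h1 := glaisher_aux d hd (p - m) (by lia) hj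
  refine ⟨d (p - m), ?_, ?_⟩
  · rw [← hd _ (by lia) hj, show p - (p - m) = m by lia]
  have hm0 : (m : ZMod p) ≠ 0 := by
    rw [Ne, ZMod.natCast_eq_zero_iff]
    exact Nat.not_dvd_of_pos_of_lt (by lia) hmp
  let B : pIntegral p := ⟨bernoulli (p - m), bernoulli_mem_pIntegral _ hj⟩
  let I : pIntegral p := ⟨(m : ℚ)⁻¹, inv_natCast_mem_pIntegral (by lia) hmp⟩
  have hI : I * (m : pIntegral p) = 1 := by
    apply Subtype.ext
    have : (m : ℚ) ≠ 0 := by positivity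
    simp [I, this]
  have hI2 : reduction p I * (m : ZMod p) = 1 := by
    rw [← map_natCast (reduction p), ← map_mul, hI, map_one]
  have h2 : ((bernoulli' (p - m) / (m : ℚ) : ℚ) : ZMod p) =
      (-1) ^ (p - m) * reduction p B * reduction p I := by
    have : bernoulli' (p - m) / (m : ℚ) = (((-1) ^ (p - m) * B * I : pIntegral p) : ℚ) := by
      push_cast
      rw [← neg_one_pow_mul_bernoulli, div_eq_mul_inv]
    rw [this]
    change reduction p _ = _
    simp
  have h3 : reduction p B = ((bernoulli (p - m) : ℚ) : ZMod p) := rfl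
  rw [Nat.cast_sub hmp.le, CharP.cast_eq_zero, ← h3] at h1
  rw [h2]
  apply mul_left_cancel₀ hm0
  linear_combination -h1 - (-1) ^ (p - m) * reduction p B * hI2

/-! ### The terminating very well poised `₅F₄` sum -/

section Poch

variable {R : Type*} [CommRing R]

@[simp] lemma poch_zero (x : R) : poch x 0 = 1 := by simp [poch]

lemma poch_succ (x : R) (n : ℕ) : poch x (n + 1) = poch x n * (x + n) := by
  simp [poch, ascPochhammer_succ_right]

lemma poch_succ_left (x : R) (n : ℕ) : poch x (n + 1) = x * poch (x + 1) n := by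
  simp [poch, ascPochhammer_succ_left, Polynomial.eval_comp]

lemma map_poch {S : Type*} [CommRing S] (f : R →+* S) (x : R) (n : ℕ) :
    f (poch x n) = poch (f x) n := by
  induction n with
  | zero => simp
  | succ n ih => simp [poch_succ, ih]

lemma poch_ne_zero [IsDomain R] {x : R} (n : ℕ) (h : ∀ i < n, x + i ≠ 0) : poch x n ≠ 0 := by
  induction n with
  | zero => simp
  | succ n ih =>
    rw [poch_succ]
    exact mul_ne_zero (ih fun i hi => h i (by lia)) (h n (by lia))

lemma isUnit_poch {x : R} (n : ℕ) (h : ∀ i < n, IsUnit (x + i)) : IsUnit (poch x n) := by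
  induction n with
  | zero => simp
  | succ n ih =>
    rw [poch_succ]
    exact (ih fun i hi => h i (by lia)).mul (h n (by lia))

end Poch

variable {K : Type*} [Field K]

/-- The summand of the terminating very well poised `₅F₄(1)` series with parameters
`a; b, c, -N`, multiplied by `a`. The factor `(-1) ^ n * N.choose n` is `(-N)_n / n!`. -/
noncomputable def dougallTerm (a b c : K) (N n : ℕ) : K :=
  (-1) ^ n * N.choose n * (a + 2 * n) * (poch a n * poch b n * poch c n) /
    (poch (1 + a - b) n * poch (1 + a - c) n * poch (1 + a + N) n)

/-- The induction step of `sum_dougallTerm_telescope`, where `key` carries the polynomial identity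
and the other variables stand for the factors of the fractions. -/
lemma dougall_step {w s u v P Q r x y U X W α β γ : K} (hw : w ≠ 0) (hs : s ≠ 0) (hu : u ≠ 0)
    (hv : v ≠ 0) (hP : P ≠ 0) (hQ : Q ≠ 0) (hr : r ≠ 0) (e A B C : K)
    (key : (x + y) * U * W - x * X * W * s - x * α * β * γ - y * u * v * s = 0) :
    e * y * w * (A * B * C) / (P * Q * (w * r)) +
      (U * (e * (-1) * (y + x) * W * (A * B * C) / (P * u * (Q * v) * (r * s))) -
        w * X * (e * (-1) * x * W * (A * B * C) / (P * u * (Q * v) * (w * r)))) =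
      e * (-1) * x * w * (A * α * (B * β) * (C * γ)) / (P * u * (Q * v) * (w * (r * s))) := by
  field_simp
  linear_combination (-(e * A * B * C)) * key

/-- The telescoping (Wilf–Zeilberger) certificate for the recursion in `N` of the sum of
`dougallTerm a b c N`, in summed form. -/
lemma sum_dougallTerm_telescope (a b c : K) (h1 : ∀ n : ℕ, 1 + a - b + n ≠ 0)
    (h2 : ∀ n : ℕ, 1 + a - c + n ≠ 0) (h3 : ∀ n : ℕ, 1 + a + n ≠ 0) (N m : ℕ) :
    ∑ n ∈ range (m + 1), ((1 + a - b + N) * (1 + a - c + N) * dougallTerm a b c (N + 1) n -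
        (1 + a + N) * (1 + a - b - c + N) * dougallTerm a b c N n) =
      (-1) ^ m * N.choose m * (1 + a + N) *
        (poch a (m + 1) * poch b (m + 1) * poch c (m + 1)) /
        (poch (1 + a - b) m * poch (1 + a - c) m * poch (1 + a + N) (m + 1)) := by
  have hN := h3 N
  induction m with
  | zero =>
    simp only [zero_add, sum_range_one, dougallTerm, poch_succ, poch_zero, Nat.choose_zero_right,
      Nat.cast_zero, add_zero, pow_zero, one_mul, mul_zero, Nat.cast_one, div_one, mul_one]
    field_simp
    ring
  | succ m ih =>
    rw [sum_range_succ, ih]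
    unfold dougallTerm
    have hs : poch (1 + a + N) (m + 1) = (1 + a + N) * poch (1 + a + (N + 1 : ℕ)) m := by
      rw [poch_succ_left]; push_cast; ring_nf
    have hs2 : poch (1 + a + N) (m + 1 + 1) = (1 + a + N) * poch (1 + a + (N + 1 : ℕ)) (m + 1) := by
      rw [poch_succ_left]; push_cast; ring_nf
    have hr0 : poch (1 + a + (N + 1 : ℕ)) m ≠ 0 := poch_ne_zero _ fun i _ => by
      have := h3 (N + 1 + i); simpa [add_assoc] using this
    have hs0 : 1 + a + ((N + 1 : ℕ) : K) + m ≠ 0 := by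
      have := h3 (N + 1 + m); simpa [add_assoc] using this
    have hp0 : poch (1 + a - b) m ≠ 0 := poch_ne_zero _ fun i _ => h1 i
    have hq0 : poch (1 + a - c) m ≠ 0 := poch_ne_zero _ fun i _ => h2 i
    have hu0 := h1 m
    have hv0 := h2 m
    rw [hs2, hs, poch_succ (1 + a - b) m, poch_succ (1 + a - c) m, poch_succ (1 + a + (N + 1 : ℕ)) m,
      poch_succ a (m + 1), poch_succ b (m + 1), poch_succ c (m + 1)]
    generalize poch (1 + a + (N + 1 : ℕ)) m = r at *
    generalize poch (1 + a - b) m = P at *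
    generalize poch (1 + a - c) m = Q at *
    generalize poch a (m + 1) = A at *
    generalize poch b (m + 1) = B at *
    generalize poch c (m + 1) = C at *
    have hx : ((m : K) + 1) * (N.choose (m + 1) : K) = (N - m) * (N.choose m : K) := by
      rcases le_or_gt m N with h | h
      · have := congrArg (fun n : ℕ => (n : K)) (Nat.choose_succ_right_eq N m)
        push_cast [Nat.cast_sub h] at this
        linear_combination this
      · simp [Nat.choose_eq_zero_of_lt h, Nat.choose_eq_zero_of_lt (show N < m + 1 by lia)]
    rw [Nat.choose_succ_succ' N m, pow_succ]
    push_cast at hs0 ⊢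
    generalize (N.choose (m + 1) : K) = x at *
    generalize (N.choose m : K) = y at *
    have key : ((x + y) * (1 + a - b + N) * (1 + a - c + N) * (a + 2 * (m + 1))
        - x * (1 + a - b - c + N) * (a + 2 * (m + 1)) * (1 + a + (N + 1) + m)
        - x * (a + (m + 1)) * (b + (m + 1)) * (c + (m + 1))
        - y * (1 + a - b + m) * (1 + a - c + m) * (1 + a + (N + 1) + m)) = 0 := by
      linear_combination ((1 + a - b + m) * (1 + a - c + m) - ((1 + a - b + m) + (1 + a - c + m)
        + (N - m)) * (a + 2 * (m + 1))) * hx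
    refine dougall_step hN hs0 hu0 hv0 hp0 hq0 hr0 _ _ _ _ ?_
    linear_combination key

/-- The terminating very well poised `₅F₄(1)` summation theorem (a case of Dougall's). -/
lemma sum_dougallTerm (a b c : K) (h1 : ∀ n : ℕ, 1 + a - b + n ≠ 0)
    (h2 : ∀ n : ℕ, 1 + a - c + n ≠ 0) (h3 : ∀ n : ℕ, 1 + a + n ≠ 0) (N : ℕ) :
    ∑ n ∈ range (N + 1), dougallTerm a b c N n =
      a * poch (1 + a) N * poch (1 + a - b - c) N / (poch (1 + a - b) N * poch (1 + a - c) N) := by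
  induction N with
  | zero => simp [dougallTerm]
  | succ N ih =>
    have h := sum_dougallTerm_telescope a b c h1 h2 h3 N (N + 1)
    rw [sum_sub_distrib, ← mul_sum, ← mul_sum, sum_range_succ (dougallTerm a b c N), ih] at h
    have h0 : dougallTerm a b c N (N + 1) = 0 := by simp [dougallTerm]
    rw [h0] at h
    simp only [Nat.choose_succ_self, Nat.cast_zero, mul_zero, zero_mul, zero_div, add_zero] at h
    have hp0 : poch (1 + a - b) N ≠ 0 := poch_ne_zero _ fun i _ => h1 i
    have hq0 : poch (1 + a - c) N ≠ 0 := poch_ne_zero _ fun i _ => h2 i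
    have hu0 := h1 N
    have hv0 := h2 N
    rw [poch_succ, poch_succ, poch_succ, poch_succ]
    field_simp at h ⊢
    linear_combination h

/-! ### Pochhammer symbols of length `p` modulo `p²` -/

/-- The sum `sum_dougallTerm` for `N = p` with the denominators `(1 + a - b)_p` and
`(1 + a - c)_p` cleared. They contain the factors `a - b + p` and `a - c + p`, which are not units
in the intended ring `ℤ_p⟦a, b, c⟧`; the terms `u n` for `0 < n < p` do exist there. -/
lemma dougall_cleared {D : Type*} [CommRing D] [IsDomain D] {a b c : D} (ha : a ≠ 0)
    (h1 : ∀ n : ℕ, 1 + a - b + n ≠ 0) (h2 : ∀ n : ℕ, 1 + a - c + n ≠ 0)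
    (h3 : ∀ n : ℕ, 1 + a + n ≠ 0) {p : ℕ} (hp : 1 ≤ p) (u : ℕ → D) (ρ : D)
    (hu : ∀ n ∈ Icc 1 (p - 1), u n * (poch (1 + a - b) n * poch (1 + a - c) n *
      poch (1 + a + p) n) = (-1) ^ n * p.choose n * (a + 2 * n) *
        (poch (1 + a) (n - 1) * poch b n * poch c n))
    (hρ : ρ * poch (1 + a + p) (p - 1) = poch (1 + a) (p - 1)) :
    poch (1 + a - b) p * poch (1 + a - c) p * (1 + ∑ n ∈ Icc 1 (p - 1), u n) +
      (-1) ^ p * poch b p * poch c p * ρ = poch (1 + a) p * poch (1 + a - b - c) p := by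
  obtain ⟨q, rfl⟩ : ∃ q, p = q + 1 := ⟨p - 1, by lia⟩
  rw [Nat.add_sub_cancel] at *
  let K := FractionRing D
  let φ : D →+* K := algebraMap D K
  have hinj : Function.Injective φ := IsFractionRing.injective D K
  have hφ : ∀ {x : D}, x ≠ 0 → φ x ≠ 0 := fun h => (map_ne_zero_iff φ hinj).2 h
  have g1 : ∀ n : ℕ, 1 + φ a - φ b + n ≠ 0 := fun n => by simpa using hφ (h1 n)
  have g2 : ∀ n : ℕ, 1 + φ a - φ c + n ≠ 0 := fun n => by simpa using hφ (h2 n)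
  have g3 : ∀ n : ℕ, 1 + φ a + n ≠ 0 := fun n => by simpa using hφ (h3 n)
  have hp1 : ∀ n, poch (1 + φ a - φ b) n ≠ 0 := fun n => poch_ne_zero _ fun i _ => g1 i
  have hp2 : ∀ n, poch (1 + φ a - φ c) n ≠ 0 := fun n => poch_ne_zero _ fun i _ => g2 i
  have hp3 : ∀ n, poch (1 + φ a + (q + 1 : ℕ)) n ≠ 0 := fun n => poch_ne_zero _ fun i _ => by
    have := g3 (q + 1 + i)
    rwa [Nat.cast_add, ← add_assoc] at this
  have hφa := hφ ha
  have hpa : ∀ n, poch (φ a) (n + 1) = φ a * poch (1 + φ a) n := fun n => by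
    rw [poch_succ_left, add_comm]
  have main := sum_dougallTerm (φ a) (φ b) (φ c) g1 g2 g3 (q + 1)
  rw [sum_range_succ, sum_range_succ'] at main
  have ht : ∀ n ∈ range q, dougallTerm (φ a) (φ b) (φ c) (q + 1) (n + 1) = φ a * φ (u (n + 1)) := by
    intro n hn
    have := congrArg φ (hu (n + 1) (by have := mem_range.1 hn; simp; lia))
    simp only [map_mul, map_poch, map_add, map_sub, map_one, map_natCast, map_pow, map_neg,
      map_ofNat, Nat.add_sub_cancel] at this
    rw [dougallTerm, hpa, div_eq_iff (mul_ne_zero (mul_ne_zero (hp1 _) (hp2 _)) (hp3 _))]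
    linear_combination -(φ a) * this
  rw [sum_congr rfl ht, ← mul_sum] at main
  have ht0 : dougallTerm (φ a) (φ b) (φ c) (q + 1) 0 = φ a := by simp [dougallTerm]
  have htp : poch (1 + φ a - φ b) (q + 1) * poch (1 + φ a - φ c) (q + 1) *
      dougallTerm (φ a) (φ b) (φ c) (q + 1) (q + 1) =
      φ a * ((-1) ^ (q + 1) * poch (φ b) (q + 1) * poch (φ c) (q + 1) * φ ρ) := by
    have := congrArg φ hρ
    simp only [map_mul, map_poch, map_add, map_one, map_natCast] at this
    rw [dougallTerm, hpa, ← this, Nat.choose_self, poch_succ (1 + φ a + (q + 1 : ℕ)) q]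
    have e1 := hp1 (q + 1)
    have e2 := hp2 (q + 1)
    have e3 := hp3 q
    have e4 : 1 + φ a + (q + 1 : ℕ) + q ≠ 0 := by
      have := g3 (q + 1 + q)
      rwa [Nat.cast_add, ← add_assoc] at this
    rw [← mul_div_assoc, div_eq_iff (mul_ne_zero (mul_ne_zero e1 e2) (mul_ne_zero e3 e4))]
    push_cast
    ring
  have hsum : φ (∑ n ∈ Icc 1 q, u n) = ∑ n ∈ range q, φ (u (n + 1)) := by
    rw [map_sum, ← Finset.Ico_succ_right_eq_Icc, sum_Ico_eq_sum_range]
    simp [add_comm]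
  apply hinj
  simp only [map_mul, map_poch, map_add, map_sub, map_one, map_pow, map_neg, hsum]
  apply mul_left_cancel₀ hφa
  rw [ht0] at main
  have e1 := hp1 (q + 1)
  have e2 := hp2 (q + 1)
  rw [eq_div_iff (mul_ne_zero e1 e2)] at main
  linear_combination main - htp

/-- Shape of `(x + 1)_{p-1}`: the constant term is `(p - 1)!`, and all other coefficients but the
leading one are divisible by `p`. -/
lemma poch_one_add_pred {p : ℕ} (hp : 2 ≤ p) {d : ℕ → ℤ} (hd : ∀ m, 2 ≤ m → m < p →
      (ascPochhammer ℤ p).coeff m = p * d m) {R : Type*} [CommRing R] (y : R) :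
    poch (1 + y) (p - 1) =
      ((p - 1).factorial : R) + p * ∑ m ∈ Ico 2 p, (d m : R) * y ^ (m - 1) + y ^ (p - 1) := by
  obtain ⟨r, rfl⟩ : ∃ r, p = r + 2 := ⟨p - 2, by lia⟩
  rw [show r + 2 - 1 = r + 1 from rfl]
  set q : ℤ[X] := (ascPochhammer ℤ (r + 1)).comp (X + 1) with hq
  have hqX : ascPochhammer ℤ (r + 2) = X * q := ascPochhammer_succ_left ℤ (r + 1)
  have hmonic : (ascPochhammer ℤ (r + 2)).coeff (r + 2) = 1 := by
    have := (monic_ascPochhammer ℤ (r + 2)).coeff_natDegree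
    rwa [ascPochhammer_natDegree] at this
  have hcoeff : ∀ m, q.coeff m = (ascPochhammer ℤ (r + 2)).coeff (m + 1) := fun m => by
    rw [hqX, coeff_X_mul]
  have h0 : q.coeff 0 = ((r + 1).factorial : ℤ) := by
    rw [coeff_zero_eq_eval_zero, hq, eval_comp]
    simp [ascPochhammer_eval_one]
  have hdeg : q.natDegree < r + 2 := by
    have : q.natDegree ≤ r + 1 := by
      rw [hq]
      refine natDegree_comp_le.trans ?_
      rw [ascPochhammer_natDegree]
      have : (X + 1 : ℤ[X]).natDegree ≤ 1 := by
        simpa using (natDegree_X_add_C (1 : ℤ)).le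
      nlinarith
    lia
  have h1 : poch (1 + y) (r + 1) = q.eval₂ (Int.castRingHom R) y := by
    rw [poch, hq, eval₂_comp, ← ascPochhammer_map (Int.castRingHom R), eval_map]
    simp [add_comm]
  rw [h1, eval₂_eq_sum_range' _ hdeg, sum_range_succ, sum_range_succ', h0, hcoeff (r + 1), hmonic,
    sum_Ico_eq_sum_range, mul_sum, show r + 2 - 2 = r from rfl]
  have h2 : ∀ i ∈ range r, (Int.castRingHom R) (q.coeff (i + 1)) * y ^ (i + 1) =
      ((r + 2 : ℕ) : R) * ((d (2 + i) : R) * y ^ (2 + i - 1)) := by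
    intro i hi
    have := mem_range.1 hi
    rw [hcoeff, show i + 1 + 1 = 2 + i by lia, hd (2 + i) (by lia) (by lia),
      show 2 + i - 1 = i + 1 by lia]
    simp [mul_assoc]
  rw [sum_congr rfl h2]
  simp [add_comm]

section ModSq

variable {T : Type*} [CommRing T] {p : ℕ}

/-- The middle part `∑ d_m y ^ m` of `(y)_p`, where `p d_m` is the coefficient of `x ^ m` in
`(x)_p`. -/
def psiPoly {T : Type*} [CommRing T] (p : ℕ) (d : ℕ → ℤ) (y : T) : T :=
  ∑ m ∈ Ico 2 p, (d m : T) * y ^ m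

lemma natCast_mul_eq_of_zmod (hp2 : (p : T) ^ 2 = 0) {x y : ℤ} (h : (x : ZMod p) = y) :
    (p : T) * x = p * y := by
  obtain ⟨k, hk⟩ := (ZMod.intCast_eq_intCast_iff_dvd_sub x y p).1 h
  have : (y : T) = x + p * k := by
    have := congrArg (fun z : ℤ => (z : T)) hk
    push_cast at this
    linear_combination this
  rw [this]
  linear_combination (-(k : T)) * hp2

/-- Wilson's theorem. -/
lemma natCast_mul_factorial [Fact p.Prime] (hp2 : (p : T) ^ 2 = 0) :
    (p : T) * ((p - 1).factorial : T) = -p := by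
  have := natCast_mul_eq_of_zmod hp2 (x := ((p - 1).factorial : ℕ)) (y := -1)
    (by push_cast; exact ZMod.wilsons_lemma p)
  push_cast at this
  linear_combination this

lemma natCast_mul_poch_add (hp2 : (p : T) ^ 2 = 0) (y : T) (n : ℕ) :
    (p : T) * poch (y + p) n = p * poch y n := by
  induction n with
  | zero => simp
  | succ n ih =>
    rw [poch_succ, poch_succ]
    linear_combination (y + p + n) * ih + poch y n * hp2

lemma natCast_mul_add_pow (hp2 : (p : T) ^ 2 = 0) (y : T) (n : ℕ) :
    (p : T) * (y + p) ^ n = p * y ^ n := by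
  induction n with
  | zero => simp
  | succ n ih =>
    rw [pow_succ, pow_succ]
    linear_combination (y + p) * ih + y ^ n * hp2

lemma add_natCast_pow (hp2 : (p : T) ^ 2 = 0) (y : T) (n : ℕ) :
    (y + p) ^ (n + 1) = y ^ (n + 1) + (n + 1) * p * y ^ n := by
  induction n with
  | zero => simp
  | succ n ih =>
    rw [pow_succ, ih]
    push_cast
    linear_combination (n + 1) * y ^ n * hp2

variable (hp : 3 ≤ p) {d : ℕ → ℤ} (hd : ∀ m, 2 ≤ m → m < p →
      (ascPochhammer ℤ p).coeff m = p * d m) (hp2 : (p : T) ^ 2 = 0) {y : T}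
      (hy : y ^ (p - 2) = 0)

include hp hd hy

lemma poch_one_add_pred_of_pow_eq_zero : poch (1 + y) (p - 1) =
    ((p - 1).factorial : T) + p * ∑ m ∈ Ico 2 p, (d m : T) * y ^ (m - 1) := by
  rw [poch_one_add_pred (by lia) hd, pow_eq_zero_of_le (by lia) hy, add_zero]

lemma poch_prime : poch y p = ((p - 1).factorial : T) * y + p * psiPoly p d y := by
  obtain ⟨q, hq⟩ : ∃ q, p = q + 1 := ⟨p - 1, by lia⟩
  have h := poch_one_add_pred_of_pow_eq_zero hp hd hy
  have h1 : poch y p = y * poch (1 + y) (p - 1) := by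
    rw [hq, poch_succ_left, add_comm 1 y, Nat.add_sub_cancel]
  have h2 : psiPoly p d y = y * ∑ m ∈ Ico 2 p, (d m : T) * y ^ (m - 1) := by
    rw [psiPoly, mul_sum]
    refine sum_congr rfl fun m hm => ?_
    obtain ⟨k, rfl⟩ : ∃ k, m = k + 1 := ⟨m - 1, by have := mem_Ico.1 hm; lia⟩
    rw [Nat.add_sub_cancel]
    ring
  rw [h1, h, h2]
  ring

include hp2

lemma poch_one_add_prime [Fact p.Prime] :
    poch (1 + y) p = ((p - 1).factorial : T) * y + p * psiPoly p d y - p := by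
  obtain ⟨q, hq⟩ : ∃ q, p = q + 1 := ⟨p - 1, by lia⟩
  have h := poch_one_add_pred_of_pow_eq_zero hp hd hy
  have h1 : poch y p = y * poch (1 + y) (p - 1) := by
    rw [hq, poch_succ_left, add_comm 1 y, Nat.add_sub_cancel]
  have h2 : poch (1 + y) p = poch (1 + y) (p - 1) * (y + p) := by
    rw [hq, poch_succ, Nat.add_sub_cancel]
    push_cast
    ring
  rw [poch_prime hp hd hy] at h1
  have h3 := natCast_mul_factorial (T := T) hp2
  rw [h2]
  linear_combination -h1 + (p : T) * h + h3 +
    (∑ m ∈ Ico 2 p, (d m : T) * y ^ (m - 1)) * hp2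

lemma poch_one_add_add_prime : poch (1 + y + p) (p - 1) = poch (1 + y) (p - 1) := by
  rw [add_assoc, poch_one_add_pred (by lia) hd, poch_one_add_pred (by lia) hd]
  have h1 : (p : T) * ∑ m ∈ Ico 2 p, (d m : T) * (y + p) ^ (m - 1) =
      p * ∑ m ∈ Ico 2 p, (d m : T) * y ^ (m - 1) := by
    rw [mul_sum, mul_sum]
    refine sum_congr rfl fun m _ => ?_
    linear_combination (d m : T) * natCast_mul_add_pow hp2 y (m - 1)
  have h2 := add_natCast_pow hp2 y (p - 2)
  rw [show p - 2 + 1 = p - 1 by lia, hy] at h2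
  rw [h1, h2]
  ring

omit hp hd hy in
/-- The terms of the terminating sum are `-p` times those of the sum in the theorem. -/
lemma dougall_term_mod_sq [Fact p.Prime] {a B C P Q s u : T} {n : ℕ} (hn0 : 1 ≤ n) (hn : n < p)
    (hunit : IsUnit ((n * (n + a)) * (P * Q * poch (1 + a + p) n)))
    (hs : s * ((n * (n + a)) * (P * Q)) = (2 * n + a) * (B * C))
    (hu : u * (P * Q * poch (1 + a + p) n) =
      (-1) ^ n * p.choose n * (a + 2 * n) * (poch (1 + a) (n - 1) * B * C)) :
    u = -(p * s) := by
  obtain ⟨k, rfl⟩ : ∃ k, n = k + 1 := ⟨n - 1, by lia⟩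
  rw [Nat.add_sub_cancel] at hu
  have h1 : ((k + 1 : ℕ) : T) * p.choose (k + 1) = p * (p - 1).choose k := by
    have := Nat.add_one_mul_choose_eq (p - 1) k
    rw [show p - 1 + 1 = p by lia] at this
    have := congrArg (fun n : ℕ => (n : T)) this
    push_cast at this ⊢
    linear_combination -this
  have h2 : (p : T) * (p - 1).choose k = p * (-1) ^ k := by
    have := natCast_mul_eq_of_zmod (T := T) hp2 (x := ((p - 1).choose k : ℕ)) (y := (-1) ^ k) (by
      have := choose_prime_sub (p := p) 0 k (by lia)
      simpa using this)
    push_cast at this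
    exact this
  have h3 := natCast_mul_poch_add hp2 (1 + a) (k + 1)
  rw [poch_succ (1 + a) k] at h3
  have h4 : ((-1 : T) ^ k) * (-1) ^ k = 1 := by rw [← mul_pow]; simp
  apply hunit.mul_right_cancel
  rw [h2] at h1
  rw [pow_succ] at hu
  push_cast at *
  linear_combination ((k : T) + 1) * (k + 1 + a) * hu
    - (-1) ^ k * (a + 2 * (k + 1)) * (k + 1 + a) * poch (1 + a) k * B * C * h1
    - p * (a + 2 * (k + 1)) * (k + 1 + a) * poch (1 + a) k * B * C * h4
    + p * poch (1 + a + p) (k + 1) * hs + (2 * (k + 1) + a) * (B * C) * h3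

end ModSq

/-- Comparison of the coefficients of `p` in Dougall's sum for `N = p`. -/
lemma dougall_mod_sq {T : Type*} [CommRing T] {p : ℕ} [Fact p.Prime] (hp : 3 ≤ p) {d : ℕ → ℤ}
    (hd : ∀ m, 2 ≤ m → m < p → (ascPochhammer ℤ p).coeff m = p * d m) (hp2 : (p : T) ^ 2 = 0)
    {a b c S : T} (ha : a ^ (p - 2) = 0) (hb : b ^ (p - 2) = 0) (hc : c ^ (p - 2) = 0)
    (hab : (a - b) ^ (p - 2) = 0) (hac : (a - c) ^ (p - 2) = 0)
    (habc : (a - b - c) ^ (p - 2) = 0)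
    (h : poch (1 + a - b) p * poch (1 + a - c) p * (1 - p * S) - poch b p * poch c p =
      poch (1 + a) p * poch (1 + a - b - c) p) :
    p * ((a - b) * (a - c) * S) = p * ((a - b - c) * psiPoly p d a + a * psiPoly p d (a - b - c)
      + b * psiPoly p d c + c * psiPoly p d b - (a - c) * psiPoly p d (a - b)
      - (a - b) * psiPoly p d (a - c)) := by
  rw [show 1 + a - b - c = 1 + (a - b - c) by ring, add_sub_assoc, add_sub_assoc,
    poch_one_add_prime hp hd hp2 ha, poch_one_add_prime hp hd hp2 hab,
    poch_one_add_prime hp hd hp2 hac, poch_one_add_prime hp hd hp2 habc,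
    poch_prime hp hd hb, poch_prime hp hd hc] at h
  have hl := natCast_mul_factorial (T := T) hp2
  generalize ((p - 1).factorial : T) = l at *
  generalize psiPoly p d a = fa at *
  generalize psiPoly p d (a - b - c) = fd at *
  generalize psiPoly p d b = fb at *
  generalize psiPoly p d c = fc at *
  generalize psiPoly p d (a - b) = f1 at *
  generalize psiPoly p d (a - c) = f2 at *
  linear_combination -h - (l - 1) * ((a - b) * (a - c) * S) * hl
    + ((a - b) * (f2 - 1) + (a - c) * (f1 - 1) - b * fc - c * fb - a * (fd - 1)
      - (a - b - c) * (fa - 1)) * hl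
    + ((f1 - 1) * (f2 - 1) - S * (l * ((a - b) * (f2 - 1) + (a - c) * (f1 - 1))
      + p * (f1 - 1) * (f2 - 1)) - fb * fc - (fa - 1) * (fd - 1)) * hp2

/-! ### The identity modulo `p` in low degrees -/

/-- The ideal of power series of order at least `k`. -/
def orderIdeal (σ R : Type*) [CommRing R] (k : ℕ) : Ideal (MvPowerSeries σ R) where
  carrier := {f | (k : ℕ∞) ≤ f.order}
  zero_mem' := by simp
  add_mem' := fun hf hg => (le_min hf hg).trans MvPowerSeries.min_order_le_add
  smul_mem' := fun _ _ hf => (hf.trans le_add_self).trans MvPowerSeries.le_order_mul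

lemma pow_mem_orderIdeal {σ R : Type*} [CommRing R] {f : MvPowerSeries σ R}
    (hf : MvPowerSeries.constantCoeff f = 0) (k : ℕ) : f ^ k ∈ orderIdeal σ R k :=
  MvPowerSeries.le_order_pow_of_constantCoeff_eq_zero k hf

lemma isUnit_iff_toZMod_ne_zero {p : ℕ} [Fact p.Prime] {x : ℤ_[p]} :
    IsUnit x ↔ PadicInt.toZMod x ≠ 0 := by
  rw [← not_iff_not, not_not, ← RingHom.mem_ker, PadicInt.ker_toZMod,
    IsLocalRing.mem_maximalIdeal, mem_nonunits_iff]

/-- A congruence `p f ≡ p g` modulo `p²` and high order gives `f ≡ g` modulo `p` in low degrees. -/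
lemma coeff_map_eq_of_mk_eq {σ : Type*} {p : ℕ} [Fact p.Prime] {k : ℕ}
    {f g : MvPowerSeries σ ℤ_[p]}
    (h : Ideal.Quotient.mk (orderIdeal σ ℤ_[p] k ⊔ Ideal.span {(p : MvPowerSeries σ ℤ_[p]) ^ 2})
      (p * f) = Ideal.Quotient.mk _ (p * g)) {m : σ →₀ ℕ} (hm : m.degree < k) :
    MvPowerSeries.coeff m (MvPowerSeries.map (PadicInt.toZMod (p := p)) f) =
      MvPowerSeries.coeff m (MvPowerSeries.map PadicInt.toZMod g) := by
  rw [Ideal.Quotient.eq, Submodule.mem_sup] at h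
  obtain ⟨j, hj, z, hz, hjz⟩ := h
  obtain ⟨w, rfl⟩ := Ideal.mem_span_singleton'.1 hz
  have hj0 : MvPowerSeries.coeff m j = 0 :=
    MvPowerSeries.coeff_of_lt_order (lt_of_lt_of_le (by exact_mod_cast hm) hj)
  have hmul : ∀ x : MvPowerSeries σ ℤ_[p], MvPowerSeries.coeff m ((p : MvPowerSeries σ ℤ_[p]) * x)
      = p * MvPowerSeries.coeff m x := fun x => by
    rw [← map_natCast (MvPowerSeries.C (σ := σ) (R := ℤ_[p])), MvPowerSeries.coeff_C_mul]
  have h1 := congrArg (MvPowerSeries.coeff m) hjz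
  rw [show w * (p : MvPowerSeries σ ℤ_[p]) ^ 2 = p * (p * w) by ring, map_add, hj0, zero_add,
    ← mul_sub, hmul, hmul, hmul] at h1
  have hp0 : (p : ℤ_[p]) ≠ 0 := by exact_mod_cast (Fact.out : p.Prime).ne_zero
  have h2 := congrArg PadicInt.toZMod (mul_left_cancel₀ hp0 h1)
  rw [map_mul, map_natCast, CharP.cast_eq_zero, zero_mul, map_sub, map_sub] at h2
  rw [MvPowerSeries.coeff_map, MvPowerSeries.coeff_map]
  exact (sub_eq_zero.1 h2.symm)

lemma map_psiPoly {R S : Type*} [CommRing R] [CommRing S] (f : R →+* S) (p : ℕ) (d : ℕ → ℤ)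
    (y : R) : f (psiPoly p d y) = psiPoly p d (f y) := by
  simp [psiPoly]

/-- Over a field, the inverse of `MvPowerSeries` is the image of the inverse of a unit. -/
lemma map_ringInverse_eq_inv {σ k R : Type*} [Field k] [CommRing R] (f : R →+* MvPowerSeries σ k)
    {x : R} (hx : IsUnit x) : f (Ring.inverse x) = (f x)⁻¹ := by
  have h : MvPowerSeries.constantCoeff (f x) ≠ 0 :=
    (MvPowerSeries.isUnit_iff_constantCoeff.1 (hx.map f)).ne_zero
  rw [MvPowerSeries.eq_inv_iff_mul_eq_one h, ← map_mul, Ring.inverse_mul_cancel _ hx, map_one]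

/-- The theorem modulo `p`, in degrees less than `p - 2`. -/
lemma coeff_dougallSum (p : Nat.Primes) (hp : 3 ≤ (p : ℕ)) {d : ℕ → ℤ}
    (hd : ∀ m, 2 ≤ m → m < (p : ℕ) → (ascPochhammer ℤ p).coeff m = (p : ℕ) * d m)
    {a b c : MvPowerSeries (Fin 3) (ZMod p)} (ha : a = MvPowerSeries.X 0)
    (hb : b = MvPowerSeries.X 1) (hc : c = MvPowerSeries.X 2) {m : Fin 3 →₀ ℕ}
    (hm : m.degree < (p : ℕ) - 2) :
    MvPowerSeries.coeff m ((a - b) * (a - c) * dougallSum p) =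
      MvPowerSeries.coeff m ((a - b - c) * psiPoly p d a + a * psiPoly p d (a - b - c)
        + b * psiPoly p d c + c * psiPoly p d b - (a - c) * psiPoly p d (a - b)
        - (a - b) * psiPoly p d (a - c)) := by
  obtain ⟨p, hpp⟩ := p
  have : Fact p.Prime := ⟨hpp⟩
  simp only at hp hd hm a b c ha hb hc ⊢
  -- `A`, `B`, `C` lift the indeterminates to `ℤ_p⟦a, b, c⟧`, and `s n` lifts the summands
  let S := MvPowerSeries (Fin 3) ℤ_[p]
  have : IsDomain S := NoZeroDivisors.to_isDomain S
  let red : S →+* MvPowerSeries (Fin 3) (ZMod p) := MvPowerSeries.map PadicInt.toZMod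
  obtain ⟨A, hA⟩ : ∃ A : S, A = MvPowerSeries.X 0 := ⟨_, rfl⟩
  obtain ⟨B, hB⟩ : ∃ B : S, B = MvPowerSeries.X 1 := ⟨_, rfl⟩
  obtain ⟨C, hC⟩ : ∃ C : S, C = MvPowerSeries.X 2 := ⟨_, rfl⟩
  have hrA : red A = a := by rw [hA, ha]; exact MvPowerSeries.map_X _ _
  have hrB : red B = b := by rw [hB, hb]; exact MvPowerSeries.map_X _ _
  have hrC : red C = c := by rw [hC, hc]; exact MvPowerSeries.map_X _ _
  let cc : S →+* ℤ_[p] := MvPowerSeries.constantCoeff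
  have hcA : cc A = 0 := by rw [hA]; exact MvPowerSeries.constantCoeff_X _
  have hcB : cc B = 0 := by rw [hB]; exact MvPowerSeries.constantCoeff_X _
  have hcC : cc C = 0 := by rw [hC]; exact MvPowerSeries.constantCoeff_X _
  have hA0 : A ≠ 0 := by
    intro h
    have := congrArg (MvPowerSeries.coeff (Finsupp.single (0 : Fin 3) 1)) (hA.symm.trans h)
    simp [MvPowerSeries.coeff_X] at this
  -- factors of the denominators: nonzero in general, and units below `p`
  have hne : ∀ y : S, cc y = 0 → ∀ n : ℕ, 1 + y + n ≠ 0 := by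
    intro y hy n h
    have := congrArg cc h
    rw [map_add, map_add, hy, map_one, map_natCast, map_zero, add_zero] at this
    have h2 : ((1 + n : ℕ) : ℤ_[p]) = 0 := by push_cast; exact this
    have := Nat.cast_eq_zero.1 h2
    lia
  have hunit : ∀ y : S, ∀ n : ℕ, PadicInt.toZMod (cc y) = n → 0 < n → n < p → IsUnit y := by
    intro y n hy hn0 hn
    refine MvPowerSeries.isUnit_iff_constantCoeff.2 (isUnit_iff_toZMod_ne_zero.2 ?_)
    change PadicInt.toZMod (cc y) ≠ 0
    rw [hy, Ne, ZMod.natCast_eq_zero_iff]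
    exact Nat.not_dvd_of_pos_of_lt hn0 hn
  have hup : ∀ y : S, PadicInt.toZMod (cc y) = 1 → ∀ n, n < p → IsUnit (poch y n) := by
    intro y hy n hn
    refine isUnit_poch n fun i hi => hunit _ (1 + i) ?_ (by lia) (by lia)
    rw [map_add, map_add, hy, map_natCast, map_natCast]
    push_cast
    rfl
  have h1AB : PadicInt.toZMod (cc (1 + A - B)) = 1 := by simp [hcA, hcB]
  have h1AC : PadicInt.toZMod (cc (1 + A - C)) = 1 := by simp [hcA, hcC]
  have h1A : PadicInt.toZMod (cc (1 + A + p)) = 1 := by simp [hcA]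
  have hnA : ∀ n : ℕ, 1 ≤ n → n < p → IsUnit ((n : S) * (n + A)) := by
    intro n hn0 hn
    refine (hunit _ n ?_ hn0 hn).mul (hunit _ n ?_ hn0 hn)
    · simp
    · simp [hcA]
  let P : ℕ → S := fun n => poch (1 + A - B) n * poch (1 + A - C) n
  have hP : ∀ n, n < p → IsUnit (P n) := fun n hn => (hup _ h1AB n hn).mul (hup _ h1AC n hn)
  let s : ℕ → S := fun n => ((2 * n + A) * Ring.inverse ((n : S) * (n + A))) *
    ((poch B n * poch C n) * Ring.inverse (P n))
  let u : ℕ → S := fun n => (-1) ^ n * p.choose n * (A + 2 * n) *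
    (poch (1 + A) (n - 1) * poch B n * poch C n) * Ring.inverse (P n * poch (1 + A + p) n)
  let ρ : S := poch (1 + A) (p - 1) * Ring.inverse (poch (1 + A + p) (p - 1))
  have hρ : ρ * poch (1 + A + p) (p - 1) = poch (1 + A) (p - 1) := by
    simp only [ρ]
    rw [mul_assoc, Ring.inverse_mul_cancel _ (hup _ h1A _ (by lia)), mul_one]
  have hu : ∀ n ∈ Icc 1 (p - 1), u n * (P n * poch (1 + A + p) n) =
      (-1) ^ n * p.choose n * (A + 2 * n) * (poch (1 + A) (n - 1) * poch B n * poch C n) := by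
    intro n hn
    have hn := mem_Icc.1 hn
    simp only [u]
    rw [mul_assoc, Ring.inverse_mul_cancel _ ((hP n (by lia)).mul (hup _ h1A n (by lia))), mul_one]
  have hs : ∀ n ∈ Icc 1 (p - 1), s n * (((n : S) * (n + A)) * P n) =
      (2 * n + A) * (poch B n * poch C n) := by
    intro n hn
    have hn := mem_Icc.1 hn
    have e1 := Ring.inverse_mul_cancel _ (hnA n hn.1 (by lia))
    have e2 := Ring.inverse_mul_cancel _ (hP n (by lia))
    simp only [s]
    linear_combination (2 * n + A) * (poch B n * poch C n) * Ring.inverse (P n) * P n * e1 +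
      (2 * n + A) * (poch B n * poch C n) * e2
  have hred : red (∑ n ∈ Icc 1 (p - 1), s n) = dougallSum ⟨p, hpp⟩ := by
    rw [map_sum]
    simp only [dougallSum]
    rw [← ha, ← hb, ← hc]
    refine sum_congr rfl fun n hn => ?_
    have hn := mem_Icc.1 hn
    simp only [s]
    rw [map_mul, map_mul, map_mul, map_ringInverse_eq_inv red (hnA n hn.1 (by lia)),
      map_ringInverse_eq_inv red (hP n (by lia))]
    simp only [P, map_mul, map_add, map_sub, map_poch, map_natCast, map_one, map_ofNat, hrA, hrB,
      hrC]
  have main := dougall_cleared hA0 (by simpa [add_sub_assoc] using hne (A - B) (by simp [hcA, hcB]))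
    (by simpa [add_sub_assoc] using hne (A - C) (by simp [hcA, hcC])) (hne A hcA)
    (by lia : 1 ≤ p) u ρ hu hρ
  -- reduction modulo `p²` and modulo terms of degree at least `p - 2`
  let I : Ideal S := orderIdeal (Fin 3) ℤ_[p] (p - 2) ⊔ Ideal.span {(p : S) ^ 2}
  let π : S →+* S ⧸ I := Ideal.Quotient.mk I
  have hπp : ∀ n : ℕ, π (n : S) = n := map_natCast π
  have hp2 : ((p : ℕ) : S ⧸ I) ^ 2 = 0 := by
    rw [← map_natCast π, ← map_pow]
    exact Ideal.Quotient.eq_zero_iff_mem.2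
      (Ideal.mem_sup_right (Ideal.mem_span_singleton_self _))
  have hnil : ∀ y : S, cc y = 0 → π y ^ (p - 2) = 0 := by
    intro y hy
    rw [← map_pow]
    exact Ideal.Quotient.eq_zero_iff_mem.2 (Ideal.mem_sup_left (pow_mem_orderIdeal hy _))
  have hπρ : π ρ = 1 := by
    have e1 := congrArg π hρ
    have e2 := (hup _ h1A (p - 1) (by lia)).map π
    simp only [map_mul, map_poch, map_add, map_one] at e1 e2
    rw [hπp] at e1 e2
    rw [← poch_one_add_add_prime hp hd hp2 (hnil A hcA)] at e1
    apply e2.mul_right_cancel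
    rw [e1, one_mul]
  have hπu : ∀ n ∈ Icc 1 (p - 1), π (u n) = -(p * π (s n)) := by
    intro n hn
    have e1 := congrArg π (hs n hn)
    have e2 := congrArg π (hu n hn)
    have hn := mem_Icc.1 hn
    have e3 := ((hnA n hn.1 (by lia)).mul ((hP n (by lia)).mul
      (hup _ h1A n (by lia)))).map π
    simp only [P, map_mul, map_poch, map_add, map_sub, map_one, map_pow, map_neg,
      map_ofNat, hπp] at e1 e2 e3
    exact dougall_term_mod_sq hp2 hn.1 (by lia) e3 e1 e2
  have main2 := congrArg π main
  have hodd : (-1 : S ⧸ I) ^ p = -1 := (hpp.odd_of_ne_two (by lia)).neg_one_pow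
  simp only [map_mul, map_poch, map_add, map_sub, map_one, map_pow, map_neg, map_sum,
    hπρ, hodd] at main2
  rw [sum_congr rfl hπu, sum_neg_distrib, ← mul_sum] at main2
  have key := dougall_mod_sq hp hd hp2 (hnil A hcA) (hnil B hcB) (hnil C hcC)
    (a := π A) (b := π B) (c := π C) (S := ∑ n ∈ Icc 1 (p - 1), π (s n))
    (by rw [← map_sub]; exact hnil _ (by simp [hcA, hcB]))
    (by rw [← map_sub]; exact hnil _ (by simp [hcA, hcC]))
    (by rw [← map_sub, ← map_sub]; exact hnil _ (by simp [hcA, hcB, hcC]))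
    (by linear_combination main2)
  have key2 : π (p * ((A - B) * (A - C) * ∑ n ∈ Icc 1 (p - 1), s n)) =
      π (p * ((A - B - C) * psiPoly p d A + A * psiPoly p d (A - B - C)
        + B * psiPoly p d C + C * psiPoly p d B - (A - C) * psiPoly p d (A - B)
        - (A - B) * psiPoly p d (A - C))) := by
    simp only [map_mul, map_add, map_sub, map_sum, map_psiPoly, hπp]
    exact key
  have fin := coeff_map_eq_of_mk_eq key2 hm
  change MvPowerSeries.coeff m (red _) = MvPowerSeries.coeff m (red _) at fin
  rw [map_mul, hred] at fin
  simpa only [map_mul, map_add, map_sub, map_psiPoly, hrA, hrB, hrC] using fin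

/-! ### Passage to `𝒜⟦a, b, c⟧` -/

lemma toA_congr {f g : ∀ p : Nat.Primes, ZMod (p : ℕ)} (N : ℕ)
    (h : ∀ p : Nat.Primes, N < p → f p = g p) : toA f = toA g := by
  refine Ideal.Quotient.eq.2 ?_
  change {p : Nat.Primes | (f - g) p ≠ 0}.Finite
  refine Set.Finite.subset (Set.Finite.preimage Subtype.val_injective.injOn (Set.finite_Iic N))
    fun p hp => ?_
  by_contra hN
  exact hp (sub_eq_zero.2 (h p (not_le.1 hN)))

/-- `seriesToA` as a ring homomorphism. -/
def seriesHom : (∀ p : Nat.Primes, MvPowerSeries (Fin 3) (ZMod (p : ℕ))) →+*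
    MvPowerSeries (Fin 3) A where
  toFun := seriesToA
  map_one' := by
    ext m
    change toA _ = _
    simp only [Pi.one_apply, MvPowerSeries.coeff_one]
    split_ifs
    · exact map_one (Ideal.Quotient.mk finSuppIdeal)
    · exact map_zero (Ideal.Quotient.mk finSuppIdeal)
  map_zero' := by
    ext m
    exact map_zero (Ideal.Quotient.mk finSuppIdeal)
  map_add' f g := by
    ext m
    exact map_add (Ideal.Quotient.mk finSuppIdeal) _ _
  map_mul' f g := by
    ext m
    rw [MvPowerSeries.coeff_mul]
    change Ideal.Quotient.mk finSuppIdeal _ = ∑ x ∈ _, Ideal.Quotient.mk finSuppIdeal _ *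
      Ideal.Quotient.mk finSuppIdeal _
    simp only [← map_mul]
    rw [← map_sum]
    congr 1
    ext p
    rw [Finset.sum_apply, Pi.mul_apply, MvPowerSeries.coeff_mul]
    rfl

lemma seriesHom_apply (f : ∀ p : Nat.Primes, MvPowerSeries (Fin 3) (ZMod (p : ℕ))) :
    seriesHom f = seriesToA f := rfl

lemma coeff_seriesHom (f : ∀ p : Nat.Primes, MvPowerSeries (Fin 3) (ZMod (p : ℕ)))
    (m : Fin 3 →₀ ℕ) : MvPowerSeries.coeff m (seriesHom f) =
      Ideal.Quotient.mk finSuppIdeal fun p => MvPowerSeries.coeff m (f p) := rfl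

lemma seriesHom_X (i : Fin 3) : seriesHom (fun _ => MvPowerSeries.X i) = MvPowerSeries.X i := by
  ext m
  rw [coeff_seriesHom]
  simp only [MvPowerSeries.coeff_X]
  split_ifs
  · exact map_one (Ideal.Quotient.mk finSuppIdeal)
  · exact map_zero (Ideal.Quotient.mk finSuppIdeal)

lemma coeff_pow_eq_zero {R : Type*} [CommRing R] {y : MvPowerSeries (Fin 3) R}
    (hy : MvPowerSeries.constantCoeff y = 0) {m : Fin 3 →₀ ℕ} {n : ℕ} (h : m.degree < n) :
    MvPowerSeries.coeff m (y ^ n) = 0 :=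
  MvPowerSeries.coeff_of_lt_order (lt_of_lt_of_le (by exact_mod_cast h)
    (MvPowerSeries.le_order_pow_of_constantCoeff_eq_zero n hy))

lemma coeff_psiA {y : MvPowerSeries (Fin 3) A} (hy : MvPowerSeries.constantCoeff y = 0)
    (m : Fin 3 →₀ ℕ) : MvPowerSeries.coeff m (psiA y) =
      ∑ n ∈ range (m.degree + 1), (if 2 ≤ n then frakZ n else 0) * MvPowerSeries.coeff m (y ^ n) := by
  rw [psiA, PowerSeries.coeff_subst (PowerSeries.HasSubst.of_constantCoeff_zero hy),
    finsum_eq_sum_of_support_subset (s := range (m.degree + 1))]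
  · simp only [psiSeries, PowerSeries.coeff_mk, smul_eq_mul]
  · intro n hn
    by_contra h
    have h0 := coeff_pow_eq_zero hy (m := m) (n := n) (by simpa using h)
    exact hn (by simp only [h0, smul_zero])

lemma frakZ_eq_zero_of_even {n : ℕ} (hn : Even n) : frakZ n = 0 := by
  have : frakZ n = toA fun _ => 0 := by
    refine toA_congr (n + 2) fun p hp => ?_
    have hodd : Odd ((p : ℕ) - n) := by
      refine Nat.Odd.sub_even (by lia) (p.2.odd_of_ne_two (by lia)) hn
    rw [bernoulli'_eq_zero_of_odd hodd (by lia)]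
    simp
  rw [this]
  exact map_zero (Ideal.Quotient.mk finSuppIdeal)

/-- `ψ_𝒜` is an odd power series, as the Bernoulli numbers of odd index exceeding `1` vanish. -/
lemma psiA_neg {y : MvPowerSeries (Fin 3) A} (hy : MvPowerSeries.constantCoeff y = 0) :
    psiA (-y) = -psiA y := by
  ext m
  rw [map_neg, coeff_psiA hy, coeff_psiA (by rw [map_neg, hy, neg_zero]), ← sum_neg_distrib]
  refine sum_congr rfl fun n _ => ?_
  rcases Nat.even_or_odd n with h | h
  · simp [frakZ_eq_zero_of_even h]
  · have := h.neg_pow y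
    rw [this, map_neg]
    exact mul_neg (α := A) _ _

/-- `ψ_𝒜(y)` is represented modulo `p` by the truncation of the series at degree `p`. -/
lemma seriesHom_psiPoly {d : Nat.Primes → ℕ → ℤ}
    (hd : ∀ (p : Nat.Primes) m, 2 ≤ m → m < (p : ℕ) →
      (d p m : ZMod (p : ℕ)) = ((bernoulli' ((p : ℕ) - m) / (m : ℚ) : ℚ) : ZMod (p : ℕ)))
    (y : ∀ p : Nat.Primes, MvPowerSeries (Fin 3) (ZMod (p : ℕ)))
    (hy : ∀ p, MvPowerSeries.constantCoeff (y p) = 0) :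
    seriesHom (fun p => psiPoly p (d p) (y p)) = psiA (seriesHom y) := by
  have hy' : MvPowerSeries.constantCoeff (seriesHom y) = 0 := by
    rw [← MvPowerSeries.coeff_zero_eq_constantCoeff_apply, coeff_seriesHom]
    simp only [MvPowerSeries.coeff_zero_eq_constantCoeff_apply, hy]
    exact map_zero (Ideal.Quotient.mk finSuppIdeal)
  ext m
  rw [coeff_psiA hy']
  have h1 : ∀ n ∈ range (m.degree + 1),
      (if 2 ≤ n then frakZ n else 0) * MvPowerSeries.coeff m (seriesHom y ^ n) =
      Ideal.Quotient.mk finSuppIdeal (fun p => (if 2 ≤ n then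
        ((bernoulli' ((p : ℕ) - n) / (n : ℚ) : ℚ) : ZMod (p : ℕ)) else 0) *
          MvPowerSeries.coeff m (y p ^ n)) := by
    intro n _
    rw [← map_pow, coeff_seriesHom]
    split_ifs
    · exact (map_mul (Ideal.Quotient.mk finSuppIdeal) _ _).symm
    · simp only [zero_mul]
      exact (map_zero (Ideal.Quotient.mk finSuppIdeal)).symm
  rw [sum_congr rfl h1, ← map_sum]
  refine toA_congr (m.degree + 2) fun p hp => ?_
  rw [Finset.sum_apply]
  have hsub : Ico 2 (m.degree + 1) ⊆ Ico 2 (p : ℕ) := Ico_subset_Ico_right (by lia)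
  have hcoe : ∀ (z : ℤ) (f : MvPowerSeries (Fin 3) (ZMod (p : ℕ))),
      MvPowerSeries.coeff m ((z : MvPowerSeries (Fin 3) (ZMod (p : ℕ))) * f) =
        z * MvPowerSeries.coeff m f := fun z f => by
    rw [← map_intCast (MvPowerSeries.C (σ := Fin 3) (R := ZMod (p : ℕ))),
      MvPowerSeries.coeff_C_mul]
  change MvPowerSeries.coeff m (psiPoly p (d p) (y p)) = _
  rw [psiPoly, map_sum, ← sum_subset hsub]
  · have hsub2 : Ico 2 (m.degree + 1) ⊆ range (m.degree + 1) := fun n hn => by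
      simp at hn ⊢; lia
    rw [← sum_subset hsub2]
    · refine sum_congr rfl fun n hn => ?_
      have hn := mem_Ico.1 hn
      rw [hcoe, if_pos hn.1, hd p n hn.1 (by lia)]
    · intro n hn hn2
      rw [if_neg (by simp at hn hn2; lia), zero_mul]
  · intro n hn hn2
    rw [hcoe, coeff_pow_eq_zero (hy p) (by simp at hn hn2; lia), mul_zero]

/-- If `f X_s = f X_t`, then the coefficient of `f` at `m` vanishes by induction on `m t`: it equals
the one at `m + s - t`. -/
lemma X_sub_X_mem_nonZeroDivisors {σ R : Type*} [CommRing R] {s t : σ} (hst : s ≠ t) :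
    (MvPowerSeries.X s - MvPowerSeries.X t : MvPowerSeries σ R) ∈ nonZeroDivisors _ := by
  classical
  rw [mem_nonZeroDivisors_iff_right]
  intro f hf
  have h : f * MvPowerSeries.X s = f * MvPowerSeries.X t := by linear_combination hf
  have key : ∀ n : ℕ, ∀ m : σ →₀ ℕ, m t = n → MvPowerSeries.coeff m f = 0 := by
    intro n
    induction n with
    | zero =>
      intro m hm
      have h1 := congrArg (MvPowerSeries.coeff (m + Finsupp.single s 1)) h
      rw [MvPowerSeries.X, MvPowerSeries.X, MvPowerSeries.coeff_add_mul_monomial,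
        MvPowerSeries.coeff_mul_monomial, if_neg] at h1
      · simpa using h1
      · intro hle
        have := hle t
        simp [hm, hst] at this
    | succ n ih =>
      intro m hm
      have h1 := congrArg (MvPowerSeries.coeff (m + Finsupp.single s 1)) h
      obtain ⟨k, rfl⟩ : ∃ k : σ →₀ ℕ, m = k + Finsupp.single t 1 := by
        refine ⟨m - Finsupp.single t 1, (tsub_add_cancel_of_le ?_).symm⟩
        rw [Finsupp.single_le_iff]; lia
      have hk : (k + Finsupp.single s 1 : σ →₀ ℕ) t = n := by
        rw [Finsupp.add_apply, Finsupp.single_eq_same] at hm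
        rw [Finsupp.add_apply, Finsupp.single_eq_of_ne hst.symm]
        lia
      rw [MvPowerSeries.X, MvPowerSeries.X, MvPowerSeries.coeff_add_mul_monomial,
        add_right_comm, MvPowerSeries.coeff_add_mul_monomial, ih _ hk] at h1
      simpa using h1
  ext m
  exact key _ m rfl

end FiniteMZV

open FiniteMZV in
theorem lemma4p2 (a b c : MvPowerSeries (Fin 3) FiniteMZV.A)
    (ha : a = MvPowerSeries.X 0) (hb : b = MvPowerSeries.X 1) (hc : c = MvPowerSeries.X 2) :
    (a - b) * (a - c) ∈ nonZeroDivisors (MvPowerSeries (Fin 3) FiniteMZV.A) ∧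
    (a - b) * (a - c) * FiniteMZV.seriesToA FiniteMZV.dougallSum =
      (a - b - c) * FiniteMZV.psiA a + a * FiniteMZV.psiA (a - b - c)
        + b * FiniteMZV.psiA c + c * FiniteMZV.psiA b
        - (c - a) * FiniteMZV.psiA (b - a) - (b - a) * FiniteMZV.psiA (c - a) := by
  refine ⟨?_, ?_⟩
  · rw [ha, hb, hc]
    exact mul_mem (X_sub_X_mem_nonZeroDivisors (by decide))
      (X_sub_X_mem_nonZeroDivisors (by decide))
  have hex : ∀ (p : Nat.Primes) (m : ℕ), ∃ d : ℤ, 2 ≤ m → m < (p : ℕ) →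
      (ascPochhammer ℤ p).coeff m = (p : ℕ) * d ∧
        (d : ZMod (p : ℕ)) = ((bernoulli' ((p : ℕ) - m) / (m : ℚ) : ℚ) : ZMod (p : ℕ)) := by
    intro p m
    by_cases h : 2 ≤ m ∧ m < (p : ℕ)
    · obtain ⟨d, hd⟩ := exists_coeff_ascPochhammer_eq (p := p) m h.1 h.2
      exact ⟨d, fun _ _ => hd⟩
    · exact ⟨0, fun h1 h2 => absurd ⟨h1, h2⟩ h⟩
  choose d hd using hex
  have hB := fun p m h1 h2 => (hd p m h1 h2).2
  let x : Fin 3 → ∀ p : Nat.Primes, MvPowerSeries (Fin 3) (ZMod (p : ℕ)) :=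
    fun i _ => MvPowerSeries.X i
  have hx : ∀ i p, MvPowerSeries.constantCoeff (x i p) = 0 := fun i p =>
    MvPowerSeries.constantCoeff_X i
  have hxa : seriesHom (x 0) = a := by rw [ha]; exact seriesHom_X 0
  have hxb : seriesHom (x 1) = b := by rw [hb]; exact seriesHom_X 1
  have hxc : seriesHom (x 2) = c := by rw [hc]; exact seriesHom_X 2
  have hca : MvPowerSeries.constantCoeff a = 0 := by rw [ha]; exact MvPowerSeries.constantCoeff_X _
  have hcb : MvPowerSeries.constantCoeff b = 0 := by rw [hb]; exact MvPowerSeries.constantCoeff_X _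
  have hcc : MvPowerSeries.constantCoeff c = 0 := by rw [hc]; exact MvPowerSeries.constantCoeff_X _
  let Ψ : (∀ p : Nat.Primes, MvPowerSeries (Fin 3) (ZMod (p : ℕ))) →
      ∀ p : Nat.Primes, MvPowerSeries (Fin 3) (ZMod (p : ℕ)) := fun y p => psiPoly p (d p) (y p)
  have hΨ : ∀ y : ∀ p : Nat.Primes, MvPowerSeries (Fin 3) (ZMod (p : ℕ)),
      (∀ p, MvPowerSeries.constantCoeff (y p) = 0) → seriesHom (Ψ y) = psiA (seriesHom y) :=
    fun y hy => seriesHom_psiPoly hB y hy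
  have key : seriesHom ((x 0 - x 1) * (x 0 - x 2) * dougallSum) =
      seriesHom ((x 0 - x 1 - x 2) * Ψ (x 0) + x 0 * Ψ (x 0 - x 1 - x 2) + x 1 * Ψ (x 2)
        + x 2 * Ψ (x 1) - (x 0 - x 2) * Ψ (x 0 - x 1) - (x 0 - x 1) * Ψ (x 0 - x 2)) := by
    ext m
    refine toA_congr (m.degree + 3) fun p hp => ?_
    exact coeff_dougallSum p (by lia) (fun m h1 h2 => (hd p m h1 h2).1) rfl rfl rfl (by lia)
  simp only [map_mul, map_add, map_sub] at key
  rw [hΨ _ (hx 0), hΨ _ (hx 1), hΨ _ (hx 2), hΨ (x 0 - x 1) fun p => by simp [hx],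
    hΨ (x 0 - x 2) fun p => by simp [hx], hΨ (x 0 - x 1 - x 2) fun p => by simp [hx]] at key
  simp only [map_sub, hxa, hxb, hxc] at key
  rw [← seriesHom_apply, key, ← neg_sub a b, ← neg_sub a c, psiA_neg (by simp [hca, hcb]),
    psiA_neg (by simp [hca, hcc])]
  ring
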